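/- Corollary 4.6. Let $A$ and $B$ be (complex, not necessarily unital) $C^*$-algebras, and let $\varphi\colon A\to B$ be a bounded linear map that is self-adjoint, that is, $\varphi(a^*)=\varphi(a)^*$ for all $a\in A$, and that preserves zero-products, that is, $\varphi(a)\varphi(b)=0$ for all $a,b\in A$ with $ab=0$. Let $C:=C^*(\varphi(A))\subseteq B$ be the sub-$C^*$-algebra of $B$ generated by the image of $\varphi$. Let $\varphi^{**}\colon A^{**}\to B^{**}$ be the bitranspose of $\varphi$, let $1$ be the unit of the von Neumann algebra $A^{**}$, and regard the multiplier algebra $M(C)$ as a subalgebra of $C^{**}\subseteq B^{**}$. Then $h:=\varphi^{**}(1)\in B^{**}$ belongs to $M(C)\cap C'$, that is, $h$ lies in $M(C)$ and commutes with every element of $C$. Moreover, there exists a $*$-homomorphism $\pi_\varphi\colon A\to M(C)\cap\{h\}'$ (that is, with values in the elements of $M(C)$ that commute with $h$) such that \[ \varphi(a)=h\,\pi_\varphi(a)\quad\text{for all } a\in A. \] It is canonical: it satisfies $\pi_\varphi(a)\varphi(b)=\varphi(ab)=\varphi(a)\pi_\varphi(b)$ for all $a,b\in A$, and it is the only $*$-homomorphism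 $\pi\colon A\to M(C)\cap\{h\}'$ with $\varphi(a)=h\pi(a)$ for all $a\in A$. -/

import Mathlib

open scoped MultiplierAlgebra

noncomputable section

/-- The bidual `A**` of a complex normed space, as a Banach space. -/
abbrev Bidual (A : Type*) [NormedAddCommGroup A] [NormedSpace ℂ A] : Type _ :=
  StrongDual ℂ (StrongDual ℂ A)

namespace Bidual

section NormedSpace

variable {A B : Type*} [NormedAddCommGroup A] [NormedSpace ℂ A]
  [NormedAddCommGroup B] [NormedSpace ℂ B]

/-- The transpose `φ* : B* → A*`, `f ↦ f ∘ φ`, of a bounded linear map `φ : A → B`. -/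
def transpose (φ : A →L[ℂ] B) : StrongDual ℂ B →L[ℂ] StrongDual ℂ A :=
  (ContinuousLinearMap.compL ℂ A B ℂ).flip φ

@[simp] theorem transpose_apply (φ : A →L[ℂ] B) (f : StrongDual ℂ B) (a : A) :
    transpose φ f a = f (φ a) := rfl

/-- The bitranspose `φ** : A** → B**` of a bounded linear map `φ : A → B`. -/
def bitranspose (φ : A →L[ℂ] B) : Bidual A →L[ℂ] Bidual B :=
  transpose (transpose φ)

@[simp] theorem bitranspose_apply (φ : A →L[ℂ] B) (x : Bidual A) (f : StrongDual ℂ B) :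
    bitranspose φ x f = x (transpose φ f) := rfl

/-- The canonical embedding `A → A**`. -/
def incl : A →L[ℂ] Bidual A := NormedSpace.inclusionInDoubleDual ℂ A

@[simp] theorem incl_apply (a : A) (f : StrongDual ℂ A) : incl a f = f a := rfl

end NormedSpace

section Algebra

variable {A : Type*} [NonUnitalCStarAlgebra A]

/-- The functional `f · a : b ↦ f (a * b)`. -/
def actRight (f : StrongDual ℂ A) (a : A) : StrongDual ℂ A :=
  f ∘L ContinuousLinearMap.mul ℂ A a

@[simp] theorem actRight_apply (f : StrongDual ℂ A) (a b : A) : actRight f a b = f (a * b) := rfl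

/-- The functional `x · f : a ↦ x (f · a)`, for `x : A**` and `f : A*`. -/
def actLeft (x : Bidual A) (f : StrongDual ℂ A) : StrongDual ℂ A :=
  x ∘L (ContinuousLinearMap.compL ℂ A A ℂ f) ∘L ContinuousLinearMap.mul ℂ A

@[simp] theorem actLeft_apply (x : Bidual A) (f : StrongDual ℂ A) (a : A) :
    actLeft x f a = x (actRight f a) := rfl

/-- The (Arens) product of the bidual: `(x □ y)(f) = x (y · f)`. It extends the product of `A`,
and for a C⋆-algebra it is the product of the von Neumann algebra `A**`. -/
def arens (x y : Bidual A) : Bidual A :=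
  x ∘L ((ContinuousLinearMap.compL ℂ A (StrongDual ℂ A) ℂ y) ∘L
    ((ContinuousLinearMap.compL ℂ A (A →L[ℂ] A) (StrongDual ℂ A)).flip
      (ContinuousLinearMap.mul ℂ A)) ∘L ContinuousLinearMap.compL ℂ A A ℂ)

@[simp] theorem arens_apply (x y : Bidual A) (f : StrongDual ℂ A) :
    arens x y f = x (actLeft y f) := rfl

theorem arens_incl_incl (a b : A) : arens (incl a) (incl b) = incl (a * b) := rfl

/-- A norm estimate used to construct the unit of the bidual. -/
theorem norm_sq_le_aux {U : Type*} [CStarAlgebra U] [PartialOrder U] [StarOrderedRing U]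
    (e u c : U) (he : 0 ≤ e) (he1 : ‖e‖ ≤ 1) :
    ‖e * u + (c - e * c)‖ ^ 2 ≤ ‖u‖ ^ 2 + ‖c‖ ^ 2 := by
  have hs : star e = e := (IsSelfAdjoint.of_nonneg he).star_eq
  have h1 : e ≤ 1 := (CStarAlgebra.norm_le_one_iff_of_nonneg e he).1 he1
  have h1' : 0 ≤ 1 - e := sub_nonneg.2 h1
  have hp : 0 ≤ e - e * e := by
    have a1 := star_left_conjugate_nonneg h1' e
    have a2 := star_left_conjugate_nonneg he (1 - e)
    have := add_nonneg a1 a2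
    simp only [star_sub, star_one, hs] at this
    convert this using 1
    noncomm_ring
  have key : ∀ v : U, star v * (e * e + (1 - e) * (1 - e)) * v ≤ star v * v := by
    intro v
    have := star_left_conjugate_nonneg (add_nonneg hp hp) v
    rw [← sub_nonneg]
    convert this using 1
    noncomm_ring
  set x := e * u + (c - e * c) with hx
  set y := (1 - e) * u - e * c with hy
  have hxy : star x * x ≤ star u * u + star c * c := by
    calc star x * x ≤ star x * x + star y * y := le_add_of_nonneg_right (star_mul_self_nonneg y)
      _ = star u * (e * e + (1 - e) * (1 - e)) * u
          + star c * (e * e + (1 - e) * (1 - e)) * c := by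
        simp only [hx, hy, star_add, star_sub, star_mul, star_one, hs]
        noncomm_ring
      _ ≤ _ := add_le_add (key u) (key c)
  have h2 := CStarAlgebra.norm_le_norm_of_nonneg_of_le (star_mul_self_nonneg x) hxy
  calc ‖x‖ ^ 2 = ‖star x * x‖ := by rw [CStarRing.norm_star_mul_self, sq]
    _ ≤ ‖star u * u + star c * c‖ := h2
    _ ≤ ‖star u * u‖ + ‖star c * c‖ := norm_add_le _ _
    _ = _ := by rw [CStarRing.norm_star_mul_self, CStarRing.norm_star_mul_self, sq, sq]

theorem norm_sq_le_aux' [PartialOrder A] [StarOrderedRing A] (e u c : A)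
    (he : 0 ≤ e) (he1 : ‖e‖ ≤ 1) : ‖e * u + (c - e * c)‖ ^ 2 ≤ ‖u‖ ^ 2 + ‖c‖ ^ 2 := by
  have := norm_sq_le_aux (e : Unitization ℂ A) (u : Unitization ℂ A) (c : Unitization ℂ A)
    (by simpa using he) (by simpa [Unitization.norm_inr] using he1)
  simpa only [← Unitization.inr_mul, ← Unitization.inr_sub, ← Unitization.inr_add,
    Unitization.norm_inr] using this

open Filter Topology in
/-- For a bounded functional `f`, the functionals `f · e` tend to `f` in norm as `e` runs through
the canonical approximate unit. -/
theorem tendsto_actRight [PartialOrder A] [StarOrderedRing A] (f : StrongDual ℂ A) :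
    Tendsto (fun e => actRight f e) (CStarAlgebra.approximateUnit A) (𝓝 f) := by
  have hl := CStarAlgebra.increasingApproximateUnit A
  rw [Metric.tendsto_nhds]
  intro ε hε
  obtain ⟨t, ht, htε⟩ : ∃ t : ℝ, 0 < t ∧ (‖f‖ / 2 + 2) * t < ε := by
    refine ⟨ε / (‖f‖ / 2 + 3), by positivity, ?_⟩
    rw [mul_div_assoc', div_lt_iff₀ (by positivity)]
    nlinarith [norm_nonneg f]
  -- a vector almost norming `f`, with positive value
  obtain ⟨u, hu1, hu⟩ : ∃ u : A, ‖u‖ ≤ 1 ∧ ‖f‖ - t ^ 2 ≤ (f u).re := by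
    obtain ⟨v, hv1, hv⟩ : ∃ v : A, ‖v‖ ≤ 1 ∧ ‖f‖ - t ^ 2 ≤ ‖f v‖ := by
      by_contra! hcon
      have hb : ‖f‖ ≤ max 0 (‖f‖ - t ^ 2) := by
        refine ContinuousLinearMap.opNorm_le_of_unit_norm (le_max_left _ _) ?_
        intro v hv
        exact (hcon v hv.le).le.trans (le_max_right _ _)
      rcases le_max_iff.1 hb with h0 | h0
      · have := hcon 0 (by simp)
        have h1 := norm_nonneg (f 0)
        nlinarith [sq_nonneg t]
      · nlinarith [pow_pos ht 2]
    obtain ⟨z, hz, hzv⟩ := RCLike.exists_norm_eq_mul_self (f v)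
    refine ⟨z • v, by simpa [norm_smul, hz] using hv1, ?_⟩
    rw [map_smul, smul_eq_mul, ← hzv]
    simpa using hv
  have h1 : ∀ᶠ e in CStarAlgebra.approximateUnit A, ‖f (e * u) - f u‖ < t ^ 2 := by
    have := ((f.continuous.tendsto u).comp (hl.tendsto_mul_right u))
    rw [Metric.tendsto_nhds] at this
    simpa [dist_eq_norm] using this (t ^ 2) (by positivity)
  filter_upwards [h1, hl.eventually_nonneg, hl.eventually_norm] with e he he0 he1
  rw [dist_eq_norm]
  refine lt_of_le_of_lt ?_ htε
  refine ContinuousLinearMap.opNorm_le_of_unit_norm (by positivity) ?_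
  intro c hc
  obtain ⟨z, hz, hzc⟩ := RCLike.exists_norm_eq_mul_self (f (c - e * c))
  have hr : ‖(actRight f e - f) c‖ = ‖f (c - e * c)‖ := by
    rw [sub_apply, actRight_apply, map_sub, norm_sub_rev]
  rw [hr]
  set r := ‖f (c - e * c)‖ with hrdef
  have h2 := norm_sq_le_aux' e u ((t : ℂ) • z • c) he0 he1
  have h3 : ‖((t : ℂ) • z • c)‖ ≤ t := by
    rw [norm_smul, norm_smul, hz, Complex.norm_real, Real.norm_of_nonneg ht.le]
    nlinarith
  set w := e * u + ((t : ℂ) • z • c - e * ((t : ℂ) • z • c)) with hw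
  have hw2 : ‖w‖ ^ 2 ≤ (1 + t ^ 2 / 2) ^ 2 := by
    have a1 : ‖u‖ ^ 2 ≤ 1 := by nlinarith [norm_nonneg u]
    have a2 : ‖((t : ℂ) • z • c)‖ ^ 2 ≤ t ^ 2 := by
      exact pow_le_pow_left₀ (norm_nonneg _) h3 2
    nlinarith [sq_nonneg (t ^ 2)]
  have hw1 : ‖w‖ ≤ 1 + t ^ 2 / 2 := (pow_le_pow_iff_left₀ (norm_nonneg _) (by positivity) two_ne_zero).1 hw2
  have hfw : f w = f (e * u) + (t : ℂ) * (r : ℂ) := by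
    have : w = e * u + (t : ℂ) • z • (c - e * c) := by
      rw [hw]; simp only [mul_smul_comm, smul_sub]
    rw [this, map_add, map_smul, map_smul, smul_eq_mul, smul_eq_mul, ← hzc]
    rfl
  have h4 : (f (e * u)).re + t * r ≤ ‖f‖ * (1 + t ^ 2 / 2) := by
    calc (f (e * u)).re + t * r = (f w).re := by
          rw [hfw, Complex.add_re, ← Complex.ofReal_mul, Complex.ofReal_re]
      _ ≤ ‖f w‖ := Complex.re_le_norm _
      _ ≤ ‖f‖ * ‖w‖ := f.le_opNorm w
      _ ≤ _ := by gcongr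
  have h5 : (f u).re - (f (e * u)).re < t ^ 2 := by
    have := Complex.abs_re_le_norm (f (e * u) - f u)
    rw [Complex.sub_re] at this
    have := (abs_le.1 this).1
    linarith
  have h6 : t * r ≤ t * ((‖f‖ / 2 + 2) * t) := by nlinarith
  exact le_of_mul_le_mul_left h6 ht

open Filter Topology in
/-- The bidual of a C⋆-algebra has a two-sided unit. -/
theorem exists_unit (A : Type*) [NonUnitalCStarAlgebra A] :
    ∃ e : Bidual A, ∀ x : Bidual A, arens e x = x ∧ arens x e = x := by
  let _ := CStarAlgebra.spectralOrder A
  have _ := CStarAlgebra.spectralOrderedRing A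
  have hl := CStarAlgebra.increasingApproximateUnit A
  let U : Ultrafilter A := Ultrafilter.of (CStarAlgebra.approximateUnit A)
  have hU : (U : Filter A) ≤ CStarAlgebra.approximateUnit A := Ultrafilter.of_le _
  obtain ⟨e, he⟩ : ∃ e : Bidual A, ∀ f : StrongDual ℂ A, Tendsto (fun a => f a) U (𝓝 (e f)) := by
    have hc := WeakDual.isCompact_closedBall (𝕜 := ℂ) (E := StrongDual ℂ A) 0 1
    obtain ⟨e, -, he⟩ := hc.ultrafilter_le_nhds
      (U.map fun a => StrongDual.toWeakDual (incl a)) (by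
        rw [le_principal_iff]
        change _ ∈ Filter.map _ (U : Filter A)
        rw [Filter.mem_map]
        filter_upwards [hU hl.eventually_norm] with a ha
        have : ‖incl a‖ ≤ 1 := by
          refine ContinuousLinearMap.opNorm_le_bound _ zero_le_one fun f => ?_
          calc ‖f a‖ ≤ ‖f‖ * ‖a‖ := f.le_opNorm a
            _ ≤ 1 * ‖f‖ := by nlinarith [norm_nonneg f]
        simpa using this)
    refine ⟨WeakDual.toStrongDual e, fun f => ?_⟩
    exact ((WeakDual.eval_continuous f).tendsto e).comp he
  refine ⟨e, fun x => ⟨?_, ?_⟩⟩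
  · ext f
    have h1 : Tendsto (fun a => x (actRight f a)) U (𝓝 (x f)) :=
      (x.continuous.tendsto f).comp ((tendsto_actRight f).mono_left hU)
    exact tendsto_nhds_unique (he (actLeft x f)) h1
  · ext f
    have : actLeft e f = f := by
      ext a
      have h1 : Tendsto (fun b => f (a * b)) U (𝓝 (f a)) :=
        (f.continuous.tendsto a).comp ((hl.tendsto_mul_left a).mono_left hU)
      exact tendsto_nhds_unique (he (actRight f a)) h1
    rw [arens_apply, this]

variable (A) in
/-- The unit of the bidual `A**`. (A two-sided unit is unique.) -/
def one : Bidual A := (exists_unit A).choose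

theorem one_arens (x : Bidual A) : arens (one A) x = x := ((exists_unit A).choose_spec x).1

theorem arens_one (x : Bidual A) : arens x (one A) = x := ((exists_unit A).choose_spec x).2

/-- The canonical embedding `M(A) → A**` of the multiplier algebra of `A` (realised by double
centralizers `m = (L, R)`) in the bidual, `m ↦ L**(1)`. Its value at `m` is the element of `A**`
with `x □ a = L a` and `a □ x = R a` for all `a ∈ A`; see the next two lemmas. -/
def ofMultiplier (m : 𝓜(ℂ, A)) : Bidual A := bitranspose m.fst (one A)

theorem ofMultiplier_arens_incl (m : 𝓜(ℂ, A)) (a : A) :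
    arens (ofMultiplier m) (incl a) = incl (m.fst a) := by
  have hm : ∀ b c : A, m.fst (b * c) = m.fst b * c := by
    intro b c
    have h0 : ∀ d : A, d * (m.fst (b * c) - m.fst b * c) = 0 := by
      intro d
      rw [mul_sub, ← mul_assoc, ← m.central, ← m.central, mul_assoc, sub_self]
    have := h0 (star (m.fst (b * c) - m.fst b * c))
    rwa [CStarRing.star_mul_self_eq_zero_iff, sub_eq_zero] at this
  ext f
  have h1 : transpose m.fst (actLeft (incl a) f) = actLeft (incl a) (transpose m.fst f) := by
    ext b
    simp [hm]
  change one A (transpose m.fst (actLeft (incl a) f)) = f (m.fst a)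
  rw [h1, ← arens_apply, one_arens]
  rfl

theorem incl_arens_ofMultiplier (m : 𝓜(ℂ, A)) (a : A) :
    arens (incl a) (ofMultiplier m) = incl (m.snd a) := by
  ext f
  have h1 : transpose m.fst (actRight f a) = actRight f (m.snd a) := by
    ext b
    simp [m.central]
  change one A (transpose m.fst (actRight f a)) = f (m.snd a)
  rw [h1, ← actLeft_apply]
  change arens (incl (m.snd a)) (one A) f = _
  rw [arens_one]
  rfl

end Algebra

end Bidual

section

variable {A B : Type*} [NonUnitalCStarAlgebra A] [NonUnitalCStarAlgebra B]

/-- The sub-C⋆-algebra `C*(φ(A))` of `B` generated by the image of `φ : A → B`. -/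
def cstarRange (φ : A →L[ℂ] B) : NonUnitalStarSubalgebra ℂ B :=
  (NonUnitalStarAlgebra.adjoin ℂ (Set.range φ)).topologicalClosure

instance cstarRange_isClosed (φ : A →L[ℂ] B) : IsClosed (cstarRange φ : Set B) :=
  NonUnitalStarSubalgebra.isClosed_topologicalClosure _

/-- The inclusion `C*(φ(A)) → B`, as a bounded linear map. -/
def cstarRangeIncl (φ : A →L[ℂ] B) : cstarRange φ →L[ℂ] B where
  toFun c := c
  map_add' _ _ := rfl
  map_smul' _ _ := rfl
  cont := continuous_subtype_val

/-- The map `φ : A → C*(φ(A))` with restricted codomain. -/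
def toCstarRange (φ : A →L[ℂ] B) (a : A) : cstarRange φ :=
  ⟨φ a, NonUnitalStarSubalgebra.le_topologicalClosure _
    (NonUnitalStarAlgebra.subset_adjoin ℂ _ (Set.mem_range_self a))⟩

end

end

/-!
The heart of the matter is that `φ (a * b) * φ c = φ a * φ (b * c)`. A bounded bilinear map `w` that
vanishes on zero products has vanishing second differences `Q x = w (x²) 1 - 2 w x x + w 1 (x²)`:
`Q` is translation invariant along scalars, and `Q a = Q a⁺ + Q a⁻` for self-adjoint `a`, so
recentring the positive parts halves the best constant in `‖Q a‖ ≤ K ‖a‖²`. Applied to translates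
of `w`, this makes `n ↦ w (uⁿ) (u*ⁿ)` an affine and bounded, hence constant, sequence for every
unitary `u`. Since unitaries span, `w x 1 = w 1 x`.

Consequently `h = φ** 1` satisfies `h φ(ab) = φ(a) φ(b) = φ(ab) h`, so it idealizes `C` and commutes
with it. The homomorphism is obtained by dividing `φ` by `h`, which is possible because the
extension `Φ` of `φ` to the unitization with `Φ 1 = h` satisfies
`Φ(u)* Φ(u) = h² = Φ(u) Φ(u)*` for unitary `u`, and `h C` is dense in `C`.
-/

open Bidual Filter Topology
open scoped ComplexStarModule

section VanishingOnZeroProducts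

variable {U X : Type*} [CStarAlgebra U] [NormedAddCommGroup X] [NormedSpace ℂ X]

/-- A bounded bilinear map that vanishes at `(y, z)` whenever `y * z = 0`. -/
def VanishesOnZeroProducts (w : U →L[ℂ] U →L[ℂ] X) : Prop :=
  ∀ y z : U, y * z = 0 → w y z = 0

/-- The second difference of a bilinear map `w` in direction `x`, which is zero if `w y z` only
depends on `y * z`. -/
noncomputable def secondDifference (w : U →L[ℂ] U →L[ℂ] X) (x : U) : X :=
  w (x * x) 1 - (2 : ℂ) • w x x + w 1 (x * x)

/-- The bilinear map `(y, z) ↦ w (a * y) (z * b)`. -/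
noncomputable def bilinTranslate (w : U →L[ℂ] U →L[ℂ] X) (a b : U) : U →L[ℂ] U →L[ℂ] X :=
  w.bilinearComp (ContinuousLinearMap.mul ℂ U a) ((ContinuousLinearMap.mul ℂ U).flip b)

@[simp] theorem bilinTranslate_apply (w : U →L[ℂ] U →L[ℂ] X) (a b y z : U) :
    bilinTranslate w a b y z = w (a * y) (z * b) := rfl

theorem VanishesOnZeroProducts.bilinTranslate {w : U →L[ℂ] U →L[ℂ] X}
    (hw : VanishesOnZeroProducts w) (a b : U) :
    VanishesOnZeroProducts (bilinTranslate w a b) := fun y z hyz =>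
  hw (a * y) (z * b) (by rw [mul_assoc, ← mul_assoc y, hyz, zero_mul, mul_zero])

theorem secondDifference_sub_smul_one (w : U →L[ℂ] U →L[ℂ] X) (x : U) (t : ℂ) :
    secondDifference w (x - t • 1) = secondDifference w x := by
  simp only [secondDifference, mul_sub, sub_mul, map_sub, map_smul, sub_apply,
    smul_apply, mul_smul_comm, smul_mul_assoc, mul_one, one_mul]
  module

theorem secondDifference_add_I_smul (w : U →L[ℂ] U →L[ℂ] X) (x y : U) :
    secondDifference w (x + Complex.I • y) = secondDifference w x - secondDifference w y +
      Complex.I • (secondDifference w (x + y) - secondDifference w x - secondDifference w y) := by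
  simp only [secondDifference, mul_add, add_mul, map_add, map_smul, add_apply,
    smul_apply, smul_add, mul_smul_comm, smul_mul_assoc, smul_smul, Complex.I_mul_I]
  module

theorem VanishesOnZeroProducts.secondDifference_sub {w : U →L[ℂ] U →L[ℂ] X}
    (hw : VanishesOnZeroProducts w) {p q : U} (hpq : p * q = 0) (hqp : q * p = 0) :
    secondDifference w (p - q) = secondDifference w p + secondDifference w q := by
  simp only [secondDifference, mul_sub, sub_mul, map_sub, sub_apply, hpq, hqp, hw p q hpq,
    hw q p hqp, map_zero, zero_apply]
  module

theorem norm_secondDifference_le (w : U →L[ℂ] U →L[ℂ] X) (x : U) :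
    ‖secondDifference w x‖ ≤ ‖w‖ * (2 * ‖(1 : U)‖ + 2) * ‖x‖ ^ 2 := by
  have hmul : ‖x * x‖ ≤ ‖x‖ ^ 2 := (norm_mul_le x x).trans_eq (sq _).symm
  calc ‖secondDifference w x‖
      ≤ ‖w (x * x) 1‖ + ‖(2 : ℂ) • w x x‖ + ‖w 1 (x * x)‖ :=
        norm_add_le_of_le (norm_sub_le _ _) le_rfl
    _ ≤ ‖w‖ * ‖x * x‖ * ‖(1 : U)‖ + 2 * (‖w‖ * ‖x‖ * ‖x‖) + ‖w‖ * ‖(1 : U)‖ * ‖x * x‖ := by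
        rw [norm_smul, Complex.norm_ofNat]
        gcongr <;> exact w.le_opNorm₂ _ _
    _ ≤ ‖w‖ * ‖x‖ ^ 2 * ‖(1 : U)‖ + 2 * (‖w‖ * ‖x‖ * ‖x‖) + ‖w‖ * ‖(1 : U)‖ * ‖x‖ ^ 2 := by
        gcongr
    _ = _ := by ring

theorem norm_sub_smul_one_le_of_nonneg [PartialOrder U] [StarOrderedRing U] {p : U} (hp : 0 ≤ p)
    {r : ℝ} (hpr : ‖p‖ ≤ 2 * r) : ‖p - (r : ℂ) • 1‖ ≤ r := by
  have hr : 0 ≤ r := by linarith [norm_nonneg p]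
  have hcfc : p - (r : ℂ) • 1 = cfc (fun t : ℝ => t - r) p := by
    rw [cfc_sub _ _ p, cfc_id' ℝ p, cfc_const r p, Algebra.algebraMap_eq_smul_one]
    rfl
  rw [hcfc]
  refine norm_cfc_le hr fun t ht => abs_le.2 ⟨?_, ?_⟩
  · linarith [spectrum_nonneg_of_nonneg hp ht]
  · have htp : |t| ≤ ‖p‖ := IsometricContinuousFunctionalCalculus.norm_spectrum_le p ht
    linarith [le_abs_self t]

theorem VanishesOnZeroProducts.norm_secondDifference_le_half {w : U →L[ℂ] U →L[ℂ] X}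
    (hw : VanishesOnZeroProducts w) {K : ℝ} (hK₀ : 0 ≤ K)
    (hK : ∀ a : U, IsSelfAdjoint a → ‖secondDifference w a‖ ≤ K * ‖a‖ ^ 2)
    {a : U} (ha : IsSelfAdjoint a) :
    ‖secondDifference w a‖ ≤ K / 2 * ‖a‖ ^ 2 := by
  let _ := CStarAlgebra.spectralOrder U
  have _ := CStarAlgebra.spectralOrderedRing U
  have hpos : ∀ p : U, 0 ≤ p → ‖p‖ ≤ ‖a‖ → ‖secondDifference w p‖ ≤ K * (‖a‖ / 2) ^ 2 := by
    intro p hp hpa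
    have hp' : ‖p - ((‖a‖ / 2 : ℝ) : ℂ) • 1‖ ≤ ‖a‖ / 2 :=
      norm_sub_smul_one_le_of_nonneg hp (by linarith)
    rw [← secondDifference_sub_smul_one w p ((‖a‖ / 2 : ℝ) : ℂ)]
    refine (hK _ ((IsSelfAdjoint.of_nonneg hp).sub ?_)).trans (by gcongr)
    exact (isSelfAdjoint_iff.2 (Complex.conj_ofReal _)).smul (.one U)
  calc ‖secondDifference w a‖
      = ‖secondDifference w a⁺ + secondDifference w a⁻‖ := by
        rw [← hw.secondDifference_sub (CFC.posPart_mul_negPart a) (CFC.negPart_mul_posPart a),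
          CFC.posPart_sub_negPart a ha]
    _ ≤ K * (‖a‖ / 2) ^ 2 + K * (‖a‖ / 2) ^ 2 :=
        norm_add_le_of_le (hpos _ (CFC.posPart_nonneg a) (CStarAlgebra.norm_posPart_le a))
          (hpos _ (CFC.negPart_nonneg a) (CStarAlgebra.norm_negPart_le a))
    _ = K / 2 * ‖a‖ ^ 2 := by ring

theorem VanishesOnZeroProducts.secondDifference_eq_zero_of_isSelfAdjoint
    {w : U →L[ℂ] U →L[ℂ] X} (hw : VanishesOnZeroProducts w) {a : U} (ha : IsSelfAdjoint a) :
    secondDifference w a = 0 := by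
  set K : ℝ := ‖w‖ * (2 * ‖(1 : U)‖ + 2)
  have hK : ∀ n : ℕ, ∀ b : U, IsSelfAdjoint b →
      ‖secondDifference w b‖ ≤ K / 2 ^ n * ‖b‖ ^ 2 := by
    intro n
    induction n with
    | zero => exact fun b _ => by simpa using norm_secondDifference_le w b
    | succ n ih =>
      intro b hb
      rw [pow_succ, ← div_div]
      exact hw.norm_secondDifference_le_half (by positivity) ih hb
  have hlim : Tendsto (fun n : ℕ => K / 2 ^ n * ‖a‖ ^ 2) atTop (𝓝 0) := by
    simpa using (tendsto_const_nhds.div_atTop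
      (tendsto_pow_atTop_atTop_of_one_lt one_lt_two)).mul_const (‖a‖ ^ 2)
  exact norm_le_zero_iff.1 (ge_of_tendsto' hlim fun n => hK n a ha)

theorem VanishesOnZeroProducts.secondDifference_eq_zero {w : U →L[ℂ] U →L[ℂ] X}
    (hw : VanishesOnZeroProducts w) (x : U) : secondDifference w x = 0 := by
  have hzero {a : U} (ha : IsSelfAdjoint a) := hw.secondDifference_eq_zero_of_isSelfAdjoint ha
  have hre : IsSelfAdjoint (ℜ x : U) := (ℜ x).2
  have him : IsSelfAdjoint (ℑ x : U) := (ℑ x).2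
  rw [← realPart_add_I_smul_imaginaryPart x, secondDifference_add_I_smul, hzero hre, hzero him,
    hzero (hre.add him)]
  simp

theorem eq_of_bounded_of_secondDifference_eq_zero {v : ℕ → X} {C : ℝ} (hC : ∀ n, ‖v n‖ ≤ C)
    (hv : ∀ n, v (n + 2) - (2 : ℂ) • v (n + 1) + v n = 0) : v 1 = v 0 := by
  have hstep : ∀ n, v (n + 1) - v n = v 1 - v 0 := by
    intro n
    induction n with
    | zero => rfl
    | succ n ih =>
      rw [← ih, ← sub_eq_zero, ← hv n]
      module
  have hlin : ∀ n, v n = v 0 + n • (v 1 - v 0) := by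
    intro n
    induction n with
    | zero => simp
    | succ n ih => rw [succ_nsmul, ← add_assoc, ← ih, ← hstep n, add_sub_cancel]
  have hbound : ∀ n : ℕ, n • ‖v 1 - v 0‖ ≤ C + C := fun n => by
    rw [← RCLike.norm_nsmul ℂ, ← add_sub_cancel_left (v 0) (n • _), ← hlin]
    exact norm_sub_le_of_le (hC n) (hC 0)
  by_contra hne
  obtain ⟨n, hn⟩ := Archimedean.arch (C + C + 1) (norm_pos_iff.2 (sub_ne_zero.2 hne))
  linarith [hbound n]

theorem norm_le_norm_one_of_mem_unitary {u : U} (hu : u ∈ unitary U) : ‖u‖ ≤ ‖(1 : U)‖ := by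
  simpa using (CStarRing.norm_coe_unitary_mul ⟨u, hu⟩ 1).le

theorem VanishesOnZeroProducts.apply_unitary_star {w : U →L[ℂ] U →L[ℂ] X}
    (hw : VanishesOnZeroProducts w) {u : U} (hu : u ∈ unitary U) : w u (star u) = w 1 1 := by
  have hrec : ∀ n : ℕ, w (u ^ (n + 2)) (star u ^ (n + 2))
      - (2 : ℂ) • w (u ^ (n + 1)) (star u ^ (n + 1)) + w (u ^ n) (star u ^ n) = 0 := by
    intro n
    have huu : u * star u = 1 := Unitary.mul_star_self_of_mem hu
    have h := (hw.bilinTranslate (u ^ n) (star u ^ (n + 2))).secondDifference_eq_zero u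
    have h1 : u * star u ^ (n + 2) = star u ^ (n + 1) := by
      rw [pow_succ' _ (n + 1), ← mul_assoc, huu, one_mul]
    have h2 : u ^ 2 * star u ^ (n + 2) = star u ^ n := by
      rw [sq, mul_assoc, h1, pow_succ', ← mul_assoc, huu, one_mul]
    simpa only [secondDifference, bilinTranslate_apply, h1, h2, one_mul, mul_one, ← sq, ← pow_add,
      ← pow_succ] using h
  have hbound : ∀ n : ℕ, ‖w (u ^ n) (star u ^ n)‖ ≤ ‖w‖ * ‖(1 : U)‖ * ‖(1 : U)‖ := fun n =>
    (w.le_opNorm₂ _ _).trans (by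
      gcongr
      · exact norm_le_norm_one_of_mem_unitary (pow_mem hu n)
      · exact norm_le_norm_one_of_mem_unitary (pow_mem (Unitary.star_mem hu) n))
  simpa using eq_of_bounded_of_secondDifference_eq_zero hbound hrec

theorem VanishesOnZeroProducts.apply_one_comm {w : U →L[ℂ] U →L[ℂ] X}
    (hw : VanishesOnZeroProducts w) (x : U) : w x 1 = w 1 x := by
  have hunitary : ∀ u ∈ unitary U, w u 1 = w 1 u := fun u hu => by
    simpa [Unitary.star_mul_self_of_mem hu] using (hw.bilinTranslate 1 u).apply_unitary_star hu
  have hx : x ∈ Submodule.span ℂ (unitary U : Set U) := by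
    rw [CStarAlgebra.span_unitary]
    trivial
  exact LinearMap.eqOn_span (f := (w.flip 1).toLinearMap) (g := (w 1).toLinearMap) hunitary hx

end VanishingOnZeroProducts

section Balanced

/-- A map `ψ` with `ψ (a * b) * ψ c = ψ a * ψ (b * c)`. Over algebras with units this says that
`ψ` is a homomorphism up to the factor `ψ 1`. -/
def IsBalanced {A C : Type*} [Mul A] [Mul C] (ψ : A → C) : Prop :=
  ∀ a b c, ψ (a * b) * ψ c = ψ a * ψ (b * c)

variable {A : Type*} [NonUnitalCStarAlgebra A]

variable (A) in
/-- The bounded linear projection of the unitization of `A` onto `A`. -/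
noncomputable def unitizationSnd : Unitization ℂ A →L[ℂ] A where
  toFun z := z.snd
  map_add' := Unitization.snd_add
  map_smul' := Unitization.snd_smul
  cont := Unitization.continuous_snd

@[simp] theorem unitizationSnd_apply (z : Unitization ℂ A) : unitizationSnd A z = z.snd := rfl

theorem snd_inr_mul_mul_snd_mul_inr (a c : A) (y z : Unitization ℂ A) :
    ((a : Unitization ℂ A) * y).snd * (z * (c : Unitization ℂ A)).snd =
      ((a : Unitization ℂ A) * (y * z) * (c : Unitization ℂ A)).snd := by
  simp only [Unitization.snd_mul, Unitization.fst_mul, Unitization.fst_inr, Unitization.snd_inr,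
    mul_add, add_mul, smul_add, smul_mul_assoc, mul_smul_comm, smul_smul, mul_assoc, zero_mul,
    mul_zero, zero_smul]
  module

theorem isBalanced_of_mul_eq_zero {B : Type*} [NonUnitalNormedRing B] [NormedSpace ℂ B]
    [IsScalarTower ℂ B B] [SMulCommClass ℂ B B] (φ : A →L[ℂ] B)
    (hφ : ∀ a b : A, a * b = 0 → φ a * φ b = 0) : IsBalanced φ := by
  intro a b c
  let w : Unitization ℂ A →L[ℂ] Unitization ℂ A →L[ℂ] B :=
    (ContinuousLinearMap.mul ℂ B).bilinearComp
      (φ ∘L unitizationSnd A ∘L ContinuousLinearMap.mul ℂ _ (a : Unitization ℂ A))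
      (φ ∘L unitizationSnd A ∘L (ContinuousLinearMap.mul ℂ _).flip (c : Unitization ℂ A))
  have hw : VanishesOnZeroProducts w := fun y z hyz =>
    hφ _ _ ((snd_inr_mul_mul_snd_mul_inr a c y z).trans (by simp [hyz]))
  simpa [w] using hw.apply_one_comm (b : Unitization ℂ A)

end Balanced

section Multipliers

variable {C : Type*} [NonUnitalCStarAlgebra C]

namespace Bidual

theorem isometry_incl : Isometry (incl : C → Bidual C) :=
  (NormedSpace.inclusionInDoubleDualLi ℂ : C →ₗᵢ[ℂ] Bidual C).isometry

theorem incl_injective : Function.Injective (incl : C → Bidual C) := isometry_incl.injective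

theorem arens_assoc (x y z : Bidual C) : arens (arens x y) z = arens x (arens y z) := by
  ext f
  refine congrArg x (ContinuousLinearMap.ext fun a => congrArg y ?_)
  refine ContinuousLinearMap.ext fun b => congrArg z ?_
  ext c
  simp [mul_assoc]

/-- The map `c ↦ x □ c` from `C` to `C**`. -/
noncomputable def arensIncl (x : Bidual C) : C →L[ℂ] Bidual C where
  toFun c := arens x (incl c)
  map_add' c d := by
    rw [map_add]
    exact ContinuousLinearMap.ext fun f => map_add x (actLeft (incl c) f) (actLeft (incl d) f)
  map_smul' r c := by
    rw [map_smul]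
    exact ContinuousLinearMap.ext fun f => map_smul x r (actLeft (incl c) f)
  cont := by
    unfold arens
    fun_prop

/-- The map `c ↦ c □ x` from `C` to `C**`. -/
noncomputable def inclArens (x : Bidual C) : C →L[ℂ] Bidual C where
  toFun c := arens (incl c) x
  map_add' c d := ContinuousLinearMap.ext fun f => map_add (actLeft x f) c d
  map_smul' r c := ContinuousLinearMap.ext fun f => map_smul (actLeft x f) r c
  cont := by
    unfold arens
    fun_prop

@[simp] theorem arensIncl_apply (x : Bidual C) (c : C) : arensIncl x c = arens x (incl c) := rfl

@[simp] theorem inclArens_apply (x : Bidual C) (c : C) : inclArens x c = arens (incl c) x := rfl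

theorem ext_incl_arens {x y : Bidual C} (hxy : ∀ c : C, arens (incl c) x = arens (incl c) y) :
    x = y := by
  let _ := CStarAlgebra.spectralOrder C
  have _ := CStarAlgebra.spectralOrderedRing C
  have := (CStarAlgebra.increasingApproximateUnit C).neBot
  ext f
  have hx := (x.continuous.tendsto f).comp (tendsto_actRight f)
  have hy := (y.continuous.tendsto f).comp (tendsto_actRight f)
  exact tendsto_nhds_unique_of_eventuallyEq hx hy (.of_forall fun c => DFunLike.congr_fun (hxy c) f)

end Bidual

theorem multiplier_fst_mul (m : 𝓜(ℂ, C)) (x y : C) : m.fst (x * y) = m.fst x * y :=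
  incl_injective (by
    rw [← ofMultiplier_arens_incl, ← arens_incl_incl, ← arens_assoc, ofMultiplier_arens_incl,
      arens_incl_incl])

theorem multiplier_ext_fst {m m' : 𝓜(ℂ, C)} (hfst : m.fst = m'.fst) : m = m' := by
  rw [← sub_eq_zero, ← norm_eq_zero, ← DoubleCentralizer.norm_fst, DoubleCentralizer.sub_fst,
    hfst, sub_self, norm_zero]

theorem multiplier_mul_coe (m : 𝓜(ℂ, C)) (c : C) : m * (c : 𝓜(ℂ, C)) = (m.fst c : 𝓜(ℂ, C)) :=
  multiplier_ext_fst (ContinuousLinearMap.ext fun x => multiplier_fst_mul m c x)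

theorem exists_incl_comp_eq (T : C →L[ℂ] Bidual C)
    (hT : ∀ c, T c ∈ Set.range (incl : C → Bidual C)) :
    ∃ L : C →L[ℂ] C, ∀ c, incl (L c) = T c := by
  choose L hL using hT
  refine ⟨⟨⟨⟨L, fun c d => incl_injective ?_⟩, fun r c => incl_injective ?_⟩, ?_⟩, hL⟩
  · simp only [map_add, hL]
  · simp only [map_smul, hL, RingHom.id_apply]
  · exact isometry_incl.isEmbedding.continuous_iff.2 (by
      simpa only [Function.comp_def, hL] using T.continuous)

theorem exists_ofMultiplier_eq {x : Bidual C}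
    (hleft : ∀ c : C, arens x (incl c) ∈ Set.range (incl : C → Bidual C))
    (hright : ∀ c : C, arens (incl c) x ∈ Set.range (incl : C → Bidual C)) :
    ∃ m : 𝓜(ℂ, C), ofMultiplier m = x := by
  obtain ⟨L, hL⟩ := exists_incl_comp_eq (arensIncl x) hleft
  obtain ⟨R, hR⟩ := exists_incl_comp_eq (inclArens x) hright
  have hcentral : ∀ c d : C, R c * d = c * L d := fun c d => incl_injective <|
    calc incl (R c * d) = arens (incl (R c)) (incl d) := rfl
      _ = arens (incl c) (incl (L d)) := by
        rw [hR, hL, inclArens_apply, arens_assoc, arensIncl_apply]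
  let m : 𝓜(ℂ, C) := ⟨(L, R), hcentral⟩
  exact ⟨m, ext_incl_arens fun c => (incl_arens_ofMultiplier m c).trans (hR c)⟩

end Multipliers

section CommutingMultipliers

variable {C : Type*} [NonUnitalCStarAlgebra C]

/-- The elements `c : C` that commute with `x : C**` and for which `x □ c` lies in `C`. -/
noncomputable def commutingIdealizer (x : Bidual C) : Submodule ℂ C :=
  LinearMap.eqLocus (arensIncl x).toLinearMap (inclArens x).toLinearMap ⊓
    (LinearMap.range (incl : C →L[ℂ] Bidual C).toLinearMap).comap (arensIncl x).toLinearMap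

theorem mem_commutingIdealizer {x : Bidual C} {c : C} : c ∈ commutingIdealizer x ↔
    arens x (incl c) = arens (incl c) x ∧ arens x (incl c) ∈ Set.range (incl : C → Bidual C) :=
  Iff.rfl

theorem isClosed_commutingIdealizer (x : Bidual C) : IsClosed (commutingIdealizer x : Set C) :=
  (isClosed_eq (arensIncl x).continuous (inclArens x).continuous).inter
    (isometry_incl.isClosedEmbedding.isClosed_range.preimage (arensIncl x).continuous)

theorem mul_mem_commutingIdealizer {x : Bidual C} {c d : C} (hc : c ∈ commutingIdealizer x)
    (hd : d ∈ commutingIdealizer x) : c * d ∈ commutingIdealizer x := by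
  obtain ⟨hcx, c', hc'⟩ := mem_commutingIdealizer.1 hc
  obtain ⟨hdx, -⟩ := mem_commutingIdealizer.1 hd
  rw [mem_commutingIdealizer, ← arens_incl_incl]
  refine ⟨?_, c' * d, ?_⟩
  · rw [← arens_assoc, hcx, arens_assoc, hdx, arens_assoc]
  · rw [← arens_incl_incl, hc', arens_assoc]

theorem exists_multiplier_of_mem_commutingIdealizer {x : Bidual C}
    (hx : ∀ c, c ∈ commutingIdealizer x) :
    ∃ m : 𝓜(ℂ, C), ofMultiplier m = x ∧ ∀ c, m.fst c = m.snd c := by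
  have hcomm (c : C) : arens x (incl c) = arens (incl c) x := (mem_commutingIdealizer.1 (hx c)).1
  have hrange (c : C) : arens x (incl c) ∈ Set.range (incl : C → Bidual C) :=
    (mem_commutingIdealizer.1 (hx c)).2
  obtain ⟨m, rfl⟩ := exists_ofMultiplier_eq hrange fun c => hcomm c ▸ hrange c
  refine ⟨m, rfl, fun c => incl_injective ?_⟩
  rw [← ofMultiplier_arens_incl, ← incl_arens_ofMultiplier, hcomm]

theorem mul_coe_eq_coe_mul_of_fst_eq_snd {m : 𝓜(ℂ, C)} (hm : ∀ c, m.fst c = m.snd c) (c : C) :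
    m * (c : 𝓜(ℂ, C)) = (c : 𝓜(ℂ, C)) * m := by
  refine multiplier_ext_fst (ContinuousLinearMap.ext fun d => ?_)
  change m.fst (c * d) = c * m.fst d
  rw [multiplier_fst_mul, hm, m.central]

end CommutingMultipliers

section Generation

variable {A C : Type*} [NonUnitalCStarAlgebra A] [NonUnitalCStarAlgebra C]

theorem mem_of_isClosed_of_mul_mem {S : Set C} (hS : IsClosed S) (hmul : ∀ a b : C, a * b ∈ S)
    (c : C) : c ∈ S := by
  let _ := CStarAlgebra.spectralOrder C
  have _ := CStarAlgebra.spectralOrderedRing C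
  have hunit := CStarAlgebra.increasingApproximateUnit C
  have := hunit.neBot
  exact hS.mem_of_tendsto (hunit.tendsto_mul_left c) (.of_forall (hmul c))

variable {ψ : A →L[ℂ] C} (hgen : Dense (NonUnitalAlgebra.adjoin ℂ (Set.range ψ) : Set C))
include hgen

theorem mem_of_map_mul_mem {S : Submodule ℂ C} (hS : IsClosed (S : Set C))
    (hmul : ∀ x y, x ∈ S → y ∈ S → x * y ∈ S) (hψ : ∀ a b, ψ (a * b) ∈ S) (c : C) : c ∈ S := by
  have hrange : ∀ a, ψ a ∈ S := mem_of_isClosed_of_mul_mem (hS.preimage ψ.continuous) hψ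
  have hle : NonUnitalAlgebra.adjoin ℂ (Set.range ψ) ≤ S.toNonUnitalSubalgebra hmul :=
    NonUnitalAlgebra.adjoin_le (Set.range_subset_iff.2 hrange)
  exact hS.closure_subset (hgen.mono hle c)

theorem multiplier_ext_map_mul {m m' : 𝓜(ℂ, C)}
    (hm : ∀ a b, m.fst (ψ (a * b)) = m'.fst (ψ (a * b))) : m = m' := by
  let S : Submodule ℂ C := LinearMap.eqLocus m.fst.toLinearMap m'.fst.toLinearMap
  have hmul (x y : C) (hx : m.fst x = m'.fst x) : m.fst (x * y) = m'.fst (x * y) := by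
    rw [multiplier_fst_mul, multiplier_fst_mul, hx]
  exact multiplier_ext_fst <| ContinuousLinearMap.ext <|
    mem_of_map_mul_mem (S := S) hgen (isClosed_eq m.fst.continuous m'.fst.continuous)
      (fun x y hx _ => hmul x y hx) hm

theorem mem_of_map_mul_map_mem {J : Submodule ℂ C} (hJ : IsClosed (J : Set C))
    (hright : ∀ x y, x ∈ J → x * y ∈ J) (hψ : ∀ a b, ψ a * ψ b ∈ J) (c : C) : c ∈ J := by
  have hmap (a : A) : ∀ y, ψ a * y ∈ J :=
    mem_of_map_mul_mem (S := J.comap (LinearMap.mulLeft ℂ (ψ a))) hgen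
      (hJ.preimage (continuous_const_mul (ψ a)))
      (fun x y hx _ => show ψ a * (x * y) ∈ J from mul_assoc (ψ a) x y ▸ hright _ y hx)
      (fun b c => hψ a (b * c))
  let T : Submodule ℂ C := ⨅ y, J.comap (LinearMap.mulRight ℂ y)
  have memT (x : C) : x ∈ T ↔ ∀ y, x * y ∈ J := by simp [T]
  have closedT : IsClosed (T : Set C) := by
    rw [Submodule.coe_iInf]
    exact isClosed_iInter fun y => hJ.preimage (continuous_mul_const y)
  have mulT (x x' : C) (hx : x ∈ T) (_ : x' ∈ T) : x * x' ∈ T :=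
    (memT _).2 fun y => mul_assoc x x' y ▸ (memT x).1 hx (x' * y)
  have hall (x y : C) : x * y ∈ J :=
    (memT x).1 (mem_of_map_mul_mem hgen closedT mulT (fun a b => (memT _).2 (hmap (a * b))) x) y
  exact mem_of_isClosed_of_mul_mem hJ hall c

theorem denseRange_multiplier_fst {h : 𝓜(ℂ, C)}
    (hh : ∀ a b, h.fst (ψ (a * b)) = ψ a * ψ b) : DenseRange h.fst := by
  let J : Submodule ℂ C := (LinearMap.range h.fst.toLinearMap).topologicalClosure
  refine fun c => mem_of_map_mul_map_mem (J := J) hgen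
    (Submodule.isClosed_topologicalClosure _) (fun x y hx => ?_)
    (fun a b => subset_closure ⟨ψ (a * b), hh a b⟩) c
  refine map_mem_closure (f := (· * y)) (continuous_mul_const y) hx ?_
  rintro _ ⟨z, rfl⟩
  exact ⟨z * y, multiplier_fst_mul h z y⟩

theorem isSelfAdjoint_of_fst_map_mul (hstar : ∀ a, ψ (star a) = star (ψ a)) {h : 𝓜(ℂ, C)}
    (hsnd : ∀ c, h.fst c = h.snd c) (hh : ∀ a b, h.fst (ψ (a * b)) = ψ a * ψ b) :
    IsSelfAdjoint h :=
  multiplier_ext_map_mul hgen fun a b =>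
    calc (star h).fst (ψ (a * b)) = star (h.fst (ψ (star b * star a))) := by
          rw [DoubleCentralizer.star_fst, ← hsnd, ← hstar, star_mul]
      _ = ψ a * ψ b := by rw [hh, star_mul, ← hstar, ← hstar, star_star, star_star]
      _ = h.fst (ψ (a * b)) := (hh a b).symm

end Generation

section Division

variable {C : Type*} [NonUnitalCStarAlgebra C]

theorem star_fst_mul_fst (m n : 𝓜(ℂ, C)) (c d : C) :
    star (m.fst c) * n.fst d = star c * (star m * n).fst d := by
  have hsnd : (star m).snd (star c) = star (m.fst c) := by
    rw [DoubleCentralizer.star_snd, star_star]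
  rw [← hsnd, (star m).central]
  rfl

theorem norm_fst_eq_of_star_mul_self_eq {m n : 𝓜(ℂ, C)} (hmn : star m * m = star n * n) (c : C) :
    ‖m.fst c‖ = ‖n.fst c‖ := by
  refine (mul_self_inj (norm_nonneg _) (norm_nonneg _)).1 ?_
  rw [← CStarRing.norm_star_mul_self, ← CStarRing.norm_star_mul_self, star_fst_mul_fst,
    star_fst_mul_fst, hmn]

theorem isRightRegular_of_denseRange_fst {h : 𝓜(ℂ, C)} (hdense : DenseRange h.fst) :
    IsRightRegular h := fun m n hmn =>
  multiplier_ext_fst <| ContinuousLinearMap.coeFn_injective <|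
    hdense.equalizer m.fst.continuous n.fst.continuous (congrArg (fun k : 𝓜(ℂ, C) => ⇑k.fst) hmn)

theorem exists_mul_eq_of_star_mul_self_eq {h x : 𝓜(ℂ, C)} (hdense : DenseRange h.fst)
    (hcomm : x * h = star h * x) (hleft : star x * x = star h * h)
    (hright : x * star x = star h * h) : ∃ m : 𝓜(ℂ, C), m * h = x := by
  let L : C →L[ℂ] C := x.fst.toLinearMap.extendOfNorm h.fst.toLinearMap
  let R : C →L[ℂ] C := (star x).fst.toLinearMap.extendOfNorm h.fst.toLinearMap
  have hL : ∀ c, L (h.fst c) = x.fst c := LinearMap.extendOfNorm_eq hdense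
    ⟨1, fun c => by simpa using (norm_fst_eq_of_star_mul_self_eq hleft c).le⟩
  have hright' : star (star x) * star x = star h * h := by rwa [star_star]
  have hR : ∀ c, R (h.fst c) = (star x).fst c := LinearMap.extendOfNorm_eq hdense
    ⟨1, fun c => by simpa using (norm_fst_eq_of_star_mul_self_eq hright' c).le⟩
  have hcentral : ∀ c d, star (R c) * d = star c * L d := by
    refine hdense.induction_on₂ (p := fun c d => star (R c) * d = star c * L d)
      (isClosed_eq (by fun_prop) (by fun_prop)) fun c d => ?_
    rw [hL, hR, star_fst_mul_fst, star_fst_mul_fst, star_star, hcomm]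
  let starC : C →L⋆[ℂ] C := (starₗᵢ ℂ : C ≃ₗᵢ⋆[ℂ] C).toContinuousLinearEquiv
  let m : 𝓜(ℂ, C) := ⟨(L, (starC.comp R).comp starC), fun c d => by
    simpa using! hcentral (star c) d⟩
  exact ⟨m, multiplier_ext_fst (ContinuousLinearMap.ext hL)⟩

end Division

section UnitizationExtend

variable {R A M : Type*} [CommRing R] [NonUnitalRing A] [Module R A] [Ring M] [Module R M]

/-- The extension of `φ : A → M` to the unitization of `A` that maps `1` to `h`. -/
noncomputable def unitizationExtend (φ : A →ₗ[R] M) (h : M) : Unitization R A →ₗ[R] M where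
  toFun z := z.fst • h + φ z.snd
  map_add' z w := by
    simp only [Unitization.fst_add, Unitization.snd_add, map_add]
    module
  map_smul' r z := by
    simp only [Unitization.fst_smul, Unitization.snd_smul, map_smul, RingHom.id_apply, smul_eq_mul]
    module

theorem unitizationExtend_apply (φ : A →ₗ[R] M) (h : M) (z : Unitization R A) :
    unitizationExtend φ h z = z.fst • h + φ z.snd := rfl

theorem unitizationExtend_star [StarRing R] [StarRing A] [StarRing M] [StarModule R M]
    {φ : A →ₗ[R] M} {h : M} (hself : IsSelfAdjoint h) (hstar : ∀ a, φ (star a) = star (φ a))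
    (z : Unitization R A) :
    unitizationExtend φ h (star z) = star (unitizationExtend φ h z) := by
  simp [unitizationExtend_apply, hstar, hself.star_eq]

theorem unitizationExtend_comm [IsScalarTower R M M] [SMulCommClass R M M] {φ : A →ₗ[R] M} {h : M}
    (hcomm : ∀ a, h * φ a = φ a * h) (z : Unitization R A) :
    h * unitizationExtend φ h z = unitizationExtend φ h z * h := by
  simp [unitizationExtend_apply, mul_add, add_mul, hcomm, mul_smul_comm, smul_mul_assoc]

theorem unitizationExtend_mul [IsScalarTower R M M] [SMulCommClass R M M] {φ : A →ₗ[R] M} {h : M}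
    (hcomm : ∀ a, h * φ a = φ a * h) (hmul : ∀ a b, φ a * φ b = h * φ (a * b))
    (z w : Unitization R A) :
    unitizationExtend φ h z * unitizationExtend φ h w = h * unitizationExtend φ h (z * w) := by
  simp only [unitizationExtend_apply, Unitization.fst_mul, Unitization.snd_mul, map_add, map_smul,
    mul_add, add_mul, smul_mul_assoc, mul_smul_comm, hmul, ← hcomm]
  module

end UnitizationExtend

section CanonicalHom

theorem exists_hom_of_forall_exists_mul_eq {R A M : Type*} [CommRing R] [NonUnitalRing A]
    [StarRing A] [Module R A] [Ring M] [StarRing M] [Module R M] [IsScalarTower R M M]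
    (φ : A →ₗ[R] M) {h : M} (hself : IsSelfAdjoint h) (hreg : IsRightRegular h)
    (hstar : ∀ a, φ (star a) = star (φ a)) (hcomm : ∀ a, h * φ a = φ a * h)
    (hmul : ∀ a b, φ a * φ b = h * φ (a * b)) (hdiv : ∀ a, ∃ m, m * h = φ a) :
    ∃ π : A →⋆ₙₐ[R] M, (∀ a, h * π a = π a * h) ∧ (∀ a, φ a = h * π a) ∧
      (∀ a b, π a * φ b = φ (a * b) ∧ φ a * π b = φ (a * b)) ∧
      ∀ ρ : A →⋆ₙₐ[R] M, (∀ a, h * ρ a = ρ a * h) → (∀ a, φ a = h * ρ a) → ρ = π := by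
  choose π hπ using hdiv
  have hcommπ (a : A) : h * π a = π a * h :=
    hreg (by simp only [mul_assoc, hπ, hcomm])
  have hleft (a b : A) : π a * φ b = φ (a * b) :=
    hreg (by simp only [mul_assoc]; rw [← hcomm, ← mul_assoc, hπ, hmul, hcomm])
  have hright (a b : A) : φ a * π b = φ (a * b) :=
    hreg (by simp only [mul_assoc, hπ]; rw [hmul, hcomm])
  let πhom : A →⋆ₙₐ[R] M :=
    { toFun := π
      map_smul' := fun r a => hreg (by
        change π (r • a) * h = r • π a * h
        rw [smul_mul_assoc, hπ, hπ, map_smul])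
      map_zero' := hreg (by simp [hπ])
      map_add' := fun a b => hreg (by simp [hπ, add_mul])
      map_mul' := fun a b => hreg (by simp [hπ, mul_assoc, hleft])
      map_star' := fun a => hreg (by
        change π (star a) * h = star (π a) * h
        rw [hπ, hstar, ← hπ, ← hcommπ, star_mul, hself.star_eq]) }
  refine ⟨πhom, hcommπ, fun a => ((hcommπ a).trans (hπ a)).symm,
    fun a b => ⟨hleft a b, hright a b⟩, fun ρ hcommρ hρ => ?_⟩
  exact NonUnitalStarAlgHom.ext fun a => hreg (show ρ a * h = π a * h by rw [← hcommρ, ← hρ, hπ])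

theorem exists_mul_eq_of_map_mul_map {A C : Type*} [NonUnitalCStarAlgebra A]
    [NonUnitalCStarAlgebra C] (φ : A →ₗ[ℂ] 𝓜(ℂ, C)) {h : 𝓜(ℂ, C)}
    (hdense : DenseRange h.fst) (hself : IsSelfAdjoint h)
    (hstar : ∀ a, φ (star a) = star (φ a)) (hcomm : ∀ a, h * φ a = φ a * h)
    (hmul : ∀ a b, φ a * φ b = h * φ (a * b)) (a : A) : ∃ m, m * h = φ a := by
  let Φ := unitizationExtend φ h
  have hΦ_one : Φ 1 = h := by simp [Φ, unitizationExtend_apply]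
  have hΦ_unitary (z w : Unitization ℂ A) (hzw : z * w = 1) : Φ z * Φ w = star h * h := by
    rw [unitizationExtend_mul hcomm hmul, hzw, hΦ_one, hself.star_eq]
  let S : Submodule ℂ (Unitization ℂ A) := (LinearMap.range (LinearMap.mulRight ℂ h)).comap Φ
  have hunitary : (unitary (Unitization ℂ A) : Set (Unitization ℂ A)) ⊆ S := fun u hu => by
    have hΦ_star : star (Φ u) = Φ (star u) := (unitizationExtend_star hself hstar u).symm
    refine exists_mul_eq_of_star_mul_self_eq hdense ?_ ?_ ?_
    · rw [hself.star_eq, unitizationExtend_comm hcomm]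
    · rw [hΦ_star, hΦ_unitary _ _ (Unitary.star_mul_self_of_mem hu)]
    · rw [hΦ_star, hΦ_unitary _ _ (Unitary.mul_star_self_of_mem hu)]
  have htop : S = ⊤ := top_le_iff.1 (CStarAlgebra.span_unitary (Unitization ℂ A) ▸
    Submodule.span_le.2 hunitary)
  have ha : (a : Unitization ℂ A) ∈ S := htop ▸ Submodule.mem_top
  simpa [S, Φ, unitizationExtend_apply] using ha

end CanonicalHom

section BidualUnit

variable {A C : Type*} [NonUnitalCStarAlgebra A] [NonUnitalCStarAlgebra C] {ψ : A →L[ℂ] C}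

theorem bitranspose_one_arens_incl_map_mul (hψ : IsBalanced ψ) (a b : A) :
    arens (bitranspose ψ (one A)) (incl (ψ (a * b))) = incl (ψ a * ψ b) := by
  ext f
  let G : StrongDual ℂ A := transpose ψ (actLeft (incl (ψ b)) f)
  have hG : transpose ψ (actLeft (incl (ψ (a * b))) f) = actLeft (incl a) G :=
    ContinuousLinearMap.ext fun a' => congrArg f (hψ a' a b).symm
  calc one A (transpose ψ (actLeft (incl (ψ (a * b))) f)) = arens (one A) (incl a) G := by
        rw [hG, arens_apply]
    _ = f (ψ a * ψ b) := by rw [one_arens]; rfl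

theorem incl_map_mul_arens_bitranspose_one (hψ : IsBalanced ψ) (a b : A) :
    arens (incl (ψ (a * b))) (bitranspose ψ (one A)) = incl (ψ a * ψ b) := by
  ext f
  let G : StrongDual ℂ A := transpose ψ (actRight f (ψ a))
  have hG : transpose ψ (actRight f (ψ (a * b))) = actRight G b :=
    ContinuousLinearMap.ext fun c => congrArg f (hψ a b c)
  calc one A (transpose ψ (actRight f (ψ (a * b)))) = arens (incl b) (one A) G := by
        rw [hG]; rfl
    _ = f (ψ a * ψ b) := by rw [arens_one]; rfl

variable (hψ : IsBalanced ψ) (hgen : Dense (NonUnitalAlgebra.adjoin ℂ (Set.range ψ) : Set C))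
include hψ hgen

theorem exists_multiplier_eq_bitranspose_one :
    ∃ h : 𝓜(ℂ, C), ofMultiplier h = bitranspose ψ (one A) ∧
      (∀ c, h.fst c = h.snd c) ∧ ∀ a b, h.fst (ψ (a * b)) = ψ a * ψ b := by
  have hmem (a b : A) : ψ (a * b) ∈ commutingIdealizer (bitranspose ψ (one A)) := by
    rw [mem_commutingIdealizer, bitranspose_one_arens_incl_map_mul hψ,
      incl_map_mul_arens_bitranspose_one hψ]
    exact ⟨rfl, Set.mem_range_self _⟩
  obtain ⟨h, hone, hsnd⟩ := exists_multiplier_of_mem_commutingIdealizer <|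
    mem_of_map_mul_mem hgen (isClosed_commutingIdealizer _)
      (fun _ _ => mul_mem_commutingIdealizer) hmem
  refine ⟨h, hone, hsnd, fun a b => incl_injective ?_⟩
  rw [← ofMultiplier_arens_incl, hone, bitranspose_one_arens_incl_map_mul hψ]

theorem exists_canonical_hom (hstar : ∀ a, ψ (star a) = star (ψ a)) :
    ∃ h : 𝓜(ℂ, C), ofMultiplier h = bitranspose ψ (one A) ∧
      (∀ c : C, h * (c : 𝓜(ℂ, C)) = (c : 𝓜(ℂ, C)) * h) ∧
      ∃ π : A →⋆ₙₐ[ℂ] 𝓜(ℂ, C),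
        (∀ a, h * π a = π a * h) ∧ (∀ a, (ψ a : 𝓜(ℂ, C)) = h * π a) ∧
        (∀ a b, π a * (ψ b : 𝓜(ℂ, C)) = ψ (a * b) ∧ (ψ a : 𝓜(ℂ, C)) * π b = ψ (a * b)) ∧
        ∀ ρ : A →⋆ₙₐ[ℂ] 𝓜(ℂ, C), (∀ a, h * ρ a = ρ a * h) →
          (∀ a, (ψ a : 𝓜(ℂ, C)) = h * ρ a) → ρ = π := by
  obtain ⟨h, hone, hsnd, hh⟩ := exists_multiplier_eq_bitranspose_one hψ hgen
  have hcomm := mul_coe_eq_coe_mul_of_fst_eq_snd hsnd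
  have hself : IsSelfAdjoint h := isSelfAdjoint_of_fst_map_mul hgen hstar hsnd hh
  have hdense : DenseRange h.fst := denseRange_multiplier_fst hgen hh
  let φ : A →ₗ[ℂ] 𝓜(ℂ, C) :=
    (DoubleCentralizer.coeHom (𝕜 := ℂ) (A := C) : C →ₗ[ℂ] 𝓜(ℂ, C)) ∘ₗ ψ.toLinearMap
  have hφstar (a : A) : φ (star a) = star (φ a) :=
    (congrArg _ (hstar a)).trans (map_star DoubleCentralizer.coeHom (ψ a))
  have hφcomm (a : A) : h * φ a = φ a * h := hcomm (ψ a)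
  have hφmul (a b : A) : φ a * φ b = h * φ (a * b) :=
    calc φ a * φ b = ((ψ a * ψ b : C) : 𝓜(ℂ, C)) :=
          (map_mul DoubleCentralizer.coeHom (ψ a) (ψ b)).symm
      _ = h * φ (a * b) := by rw [← hh]; exact (multiplier_mul_coe h _).symm
  exact ⟨h, hone, hcomm, exists_hom_of_forall_exists_mul_eq φ hself
    (isRightRegular_of_denseRange_fst hdense) hφstar hφcomm hφmul
    (exists_mul_eq_of_map_mul_map φ hdense hself hφstar hφcomm hφmul)⟩

end BidualUnit

section CstarRange

variable {A B : Type*} [NonUnitalCStarAlgebra A] [NonUnitalCStarAlgebra B] (φ : A →L[ℂ] B)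

/-- The map `φ : A → C*(φ(A))` as a bounded linear map. -/
noncomputable def toCstarRangeCLM : A →L[ℂ] cstarRange φ where
  toFun := toCstarRange φ
  map_add' _ _ := Subtype.ext (map_add φ _ _)
  map_smul' _ _ := Subtype.ext (map_smul φ _ _)
  cont := φ.continuous.subtype_mk _

theorem dense_adjoin_range_toCstarRangeCLM (hstar : ∀ a, φ (star a) = star (φ a)) :
    Dense (NonUnitalAlgebra.adjoin ℂ (Set.range (toCstarRangeCLM φ)) : Set (cstarRange φ)) := by
  have hrange : star (Set.range φ) = Set.range φ := by
    rw [← Set.image_star, ← Set.range_comp, ← star_involutive.surjective.range_comp φ]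
    exact congrArg Set.range (funext fun a => (hstar a).symm)
  let S : NonUnitalSubalgebra ℂ (cstarRange φ) :=
    NonUnitalAlgebra.adjoin ℂ (Set.range (toCstarRangeCLM φ))
  have hle : (NonUnitalStarAlgebra.adjoin ℂ (Set.range φ)).toNonUnitalSubalgebra ≤
      S.map (NonUnitalStarSubalgebraClass.subtype (cstarRange φ)) := by
    rw [NonUnitalStarAlgebra.adjoin_toNonUnitalSubalgebra, hrange, Set.union_self,
      NonUnitalAlgebra.adjoin_le_iff]
    rintro _ ⟨a, rfl⟩
    exact ⟨toCstarRangeCLM φ a, NonUnitalAlgebra.subset_adjoin ℂ (Set.mem_range_self a), rfl⟩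
  exact fun x => closure_subtype.2 (closure_mono hle x.2)

end CstarRange

theorem corollary4p6 {A B : Type*} [NonUnitalCStarAlgebra A] [NonUnitalCStarAlgebra B]
    (φ : A →L[ℂ] B)
    (hφ_star : ∀ a : A, φ (star a) = star (φ a))
    (hφ_zero : ∀ a b : A, a * b = 0 → φ a * φ b = 0) :
    ∃ h : 𝓜(ℂ, cstarRange φ),
      -- `h`, seen in `B**` through `M(C) → C** → B**`, is `φ**(1)`
      Bidual.bitranspose (cstarRangeIncl φ) (Bidual.ofMultiplier h) =
        Bidual.bitranspose φ (Bidual.one A) ∧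
      -- `h` lies in the commutant of `C`
      (∀ c : cstarRange φ, h * (c : 𝓜(ℂ, cstarRange φ)) = (c : 𝓜(ℂ, cstarRange φ)) * h) ∧
      -- the canonical homomorphism `π : A → M(C) ∩ {h}'`
      ∃ π : A →⋆ₙₐ[ℂ] 𝓜(ℂ, cstarRange φ),
        (∀ a : A, h * π a = π a * h) ∧
        (∀ a : A, (toCstarRange φ a : 𝓜(ℂ, cstarRange φ)) = h * π a) ∧
        (∀ a b : A, π a * (toCstarRange φ b : 𝓜(ℂ, cstarRange φ)) = toCstarRange φ (a * b) ∧
          (toCstarRange φ a : 𝓜(ℂ, cstarRange φ)) * π b = toCstarRange φ (a * b)) ∧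
        (∀ ρ : A →⋆ₙₐ[ℂ] 𝓜(ℂ, cstarRange φ), (∀ a : A, h * ρ a = ρ a * h) →
          (∀ a : A, (toCstarRange φ a : 𝓜(ℂ, cstarRange φ)) = h * ρ a) → ρ = π) := by
  obtain ⟨h, hone, hcanonical⟩ := exists_canonical_hom (ψ := toCstarRangeCLM φ)
    (fun a b c => Subtype.ext (isBalanced_of_mul_eq_zero φ hφ_zero a b c))
    (dense_adjoin_range_toCstarRangeCLM φ hφ_star) (fun a => Subtype.ext (hφ_star a))
  exact ⟨h, by rw [hone]; rfl, hcanonical⟩
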